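/- Throughout, $\mathbb N=\{1,2,\dots\}$, and $r\ge 2$ is an integer. A divisor $d$ of $n$ is unitary ($d\,\|\,n$) if $\gcd(d,n/d)=1$, and $\operatorname{gcud}(a,b)$ is the greatest common unitary divisor of $a,b\in\mathbb N$. Let $S\subset\mathbb N^r$ be the set of all $(n_1,\dots,n_r)$ with $\operatorname{gcud}(n_i,n_j)=1$ for all $i\ne j$ (pairwise unitarily relatively prime coordinates), let $\varrho^\times$ be its characteristic function, let $\mu_r^\times(n_1,\dots,n_r)=(-1)^{\omega(n_1)+\cdots+\omega(n_r)}$, where $\omega(n)$ is the number of distinct primes dividing $n$, and let $Q=\mu_r^\times\times\varrho^\times$ be the unitary convolution $$Q(n_1,\dots,n_r)=\sum_{d_1\|n_1,\dots,d_r\|n_r}\mu_r^\times(d_1,\dots,d_r)\,\varrho^\times(n_1/d_1,\dots,n_r/d_r).$$ (1) $Q$ is multiplicative: it is not identically zero and $Q(m_1n_1,\dots,m_rn_r)=Q(m_1,\dots,m_r)Q(n_1,\dots,n_r)$ whenever $\gcd(m_1\cdots m_r,\,n_1\cdots n_r)=1$. For every prime $p$ and all integers $\nu_1,\dots,\nu_r\ge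 0$, if the distinct positive values among $\nu_1,\dots,\nu_r$ are taken $t_1,\dots,t_q$ times, then $$Q(p^{\nu_1},\dots,p^{\nu_r})=(-1)^{t_1+\cdots+t_q}(1-t_1)\cdots(1-t_q)$$ (which is $1$ if all the $\nu_i$ are $0$, so that $q=0$). (2) The following series (for every prime $p$) and the product over all primes converge unconditionally: $$A_r^\times=\prod_p\ \sum_{\nu_1,\dots,\nu_r=0}^\infty\frac{Q(p^{\nu_1},\dots,p^{\nu_r})\,\phi(p^{\nu_1})\cdots\phi(p^{\nu_r})}{p^{2\nu_1+\cdots+2\nu_r}},$$ where $\phi$ is Euler's totient function. (3) The set $S$ has the asymptotic density $A_r^\times$, that is, $$\lim_{x_1,\dots,x_r\to\infty}\frac{\#\{(n_1,\dots,n_r)\in S:\ n_1\le x_1,\dots,n_r\le x_r\}}{x_1\cdots x_r}=A_r^\times,$$ where the real numbers $x_1,\dots,x_r$ tend to infinity independently. -/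

import Mathlib

open Filter Topology

namespace UnitaryDensity

noncomputable section

/- Arithmetic functions of `r` variables are functions `(Fin r → ℕ) → ℝ`; only their values at
tuples of positive integers are meaningful. -/

/-- The unitary divisors of `n`: the divisors `d` of `n` with `gcd (d, n / d) = 1`. -/
def unitaryDivisors (n : ℕ) : Finset ℕ :=
  n.divisors.filter fun d => Nat.gcd d (n / d) = 1

/-- The greatest common unitary divisor of two positive integers. -/
def gcud (a b : ℕ) : ℕ :=
  (unitaryDivisors a ∩ unitaryDivisors b).sup id

/-- The unitary convolution of two arithmetic functions of `r` variables. -/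
def unitaryConv {r : ℕ} (f g : (Fin r → ℕ) → ℝ) : (Fin r → ℕ) → ℝ := fun n =>
  ∑ d ∈ Fintype.piFinset (fun i => unitaryDivisors (n i)), f d * g (fun i => n i / d i)

/-- The unitary Möbius function of `r` variables, `(-1) ^ (ω(n₁) + ⋯ + ω(nᵣ))`. -/
def unitaryMoebius (r : ℕ) : (Fin r → ℕ) → ℝ := fun n =>
  (-1) ^ ∑ i, (n i).primeFactors.card

/-- The `r`-tuples of positive integers with pairwise unitarily relatively prime coordinates. -/
def pairwiseUnitaryCoprime (r : ℕ) : Set (Fin r → ℕ) :=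
  {n | (∀ i, 0 < n i) ∧ ∀ i j, i ≠ j → gcud (n i) (n j) = 1}

/-- The characteristic function of `pairwiseUnitaryCoprime r`. -/
def rhoUnitary (r : ℕ) : (Fin r → ℕ) → ℝ :=
  (pairwiseUnitaryCoprime r).indicator 1

/-- The function `Q`, the unitary convolution of the unitary Möbius function and `rhoUnitary`. -/
def Q (r : ℕ) : (Fin r → ℕ) → ℝ :=
  unitaryConv (unitaryMoebius r) (rhoUnitary r)

/-- Multiplicative functions of `r` variables. -/
def IsMultiplicative {r : ℕ} (f : (Fin r → ℕ) → ℝ) : Prop :=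
  (∃ n : Fin r → ℕ, (∀ i, 0 < n i) ∧ f n ≠ 0) ∧
    ∀ m n : Fin r → ℕ, (∀ i, 0 < m i) → (∀ i, 0 < n i) →
      Nat.gcd (∏ i, m i) (∏ i, n i) = 1 → f (fun i => m i * n i) = f m * f n

/-- `f` has the mean value `M`: the averages of `f` over the integer points of
`[1, x₁] × ⋯ × [1, xᵣ]` tend to `M` as the real numbers `x₁, …, xᵣ` tend to infinity
independently. -/
def HasMeanValue {r : ℕ} (f : (Fin r → ℕ) → ℝ) (M : ℝ) : Prop :=
  Tendsto
    (fun x : Fin r → ℝ =>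
      (∑ n ∈ Fintype.piFinset (fun i => Finset.Icc 1 ⌊x i⌋₊), f n) / ∏ i, x i)
    (Filter.pi fun _ => atTop) (𝓝 M)

/-- The set `S` of tuples has the asymptotic density `d`. -/
def HasAsymptoticDensity {r : ℕ} (S : Set (Fin r → ℕ)) (d : ℝ) : Prop :=
  HasMeanValue (S.indicator 1) d

/-- The term of the Euler factor at `p` that belongs to the exponents `ν₁, …, νᵣ`. -/
def eulerTerm (r p : ℕ) (ν : Fin r → ℕ) : ℝ :=
  Q r (fun i => p ^ ν i) * (∏ i, (Nat.totient (p ^ ν i) : ℝ)) / (p : ℝ) ^ (2 * ∑ i, ν i)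

/-- The Euler product over all primes. -/
def unitaryDensityConst (r : ℕ) : ℝ :=
  ∏' p : Nat.Primes, ∑' ν : Fin r → ℕ, eulerTerm r p ν

/-- The distinct positive values among the exponents `ν₁, …, νᵣ`. -/
def positiveValues {r : ℕ} (ν : Fin r → ℕ) : Finset ℕ :=
  (Finset.univ.image ν).filter fun v => 0 < v

/-- The number of times that the value `v` is taken by the exponents. -/
def multiplicity {r : ℕ} (ν : Fin r → ℕ) (v : ℕ) : ℕ :=
  (Finset.univ.filter fun i => ν i = v).card

end

end UnitaryDensity

namespace UnitaryDensity

/-! Möbius inversion for the unitary convolution writes `rhoUnitary r n` as the sum of `Q r d` over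
all d with dᵢ ∥ nᵢ (`sum_Q_unitaryDivisors`). Summing over a box and exchanging the sums turns the
count into ∑_d Q(d) ∏ᵢ N(dᵢ, xᵢ), where N(d, x) is the number of n ≤ x with d ∥ n
(`sum_rhoUnitary_eq_tsum`). These n are the products dm with m ≤ x/d coprime to d, so N(d, x)/x
tends to φ(d)/d² and is at most 1/d for every x > 0. Once ∑ |Q(d)|/(d₁⋯dᵣ) converges, dominated
convergence gives the density ∑_d Q(d) ∏ᵢ φ(dᵢ)/dᵢ², and multiplicativity factors this series into
the Euler product.

The convergence (`summable_abs_Q_mul`) rests on the values of Q at prime powers (`Q_prime_pow`):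
they are bounded by r^r, and the factor 1 - t kills every exponent tuple in which some positive
value occurs once, in particular those of sum 1. So the Euler factors of the majorant are 1 +
O(p⁻²).

Euler products in r variables are reduced to one variable: a bijection between exponent tuples and
ℕ, applied at every prime, encodes a tuple of positive integers by one positive integer and respects
products of coprime arguments (`decodeTuple`). -/

/-! ### Unitary divisors. -/

theorem mem_unitaryDivisors_iff {d n : ℕ} :
    d ∈ unitaryDivisors n ↔ n ≠ 0 ∧ ∃ e, n = d * e ∧ d.Coprime e := by
  unfold unitaryDivisors
  rw [Finset.mem_filter, Nat.mem_divisors]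
  constructor
  · rintro ⟨⟨⟨e, rfl⟩, h0⟩, hc⟩
    have hd : 0 < d := Nat.pos_of_ne_zero (left_ne_zero_of_mul h0)
    rw [Nat.mul_div_cancel_left _ hd] at hc
    exact ⟨h0, e, rfl, hc⟩
  · rintro ⟨h0, e, rfl, hc⟩
    have hd : 0 < d := Nat.pos_of_ne_zero (left_ne_zero_of_mul h0)
    rw [Nat.mul_div_cancel_left _ hd]
    exact ⟨⟨Dvd.intro _ rfl, h0⟩, hc⟩

theorem dvd_of_mem_unitaryDivisors {d n : ℕ} (h : d ∈ unitaryDivisors n) : d ∣ n := by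
  obtain ⟨-, e, rfl, -⟩ := mem_unitaryDivisors_iff.1 h
  exact Dvd.intro _ rfl

theorem pos_of_mem_unitaryDivisors {d n : ℕ} (h : d ∈ unitaryDivisors n) : 0 < d := by
  obtain ⟨h0, e, rfl, -⟩ := mem_unitaryDivisors_iff.1 h
  exact Nat.pos_of_ne_zero (left_ne_zero_of_mul h0)

theorem div_pos_of_mem_unitaryDivisors {d n : ℕ} (h : d ∈ unitaryDivisors n) : 0 < n / d := by
  obtain ⟨h0, e, rfl, -⟩ := mem_unitaryDivisors_iff.1 h
  rw [Nat.mul_div_cancel_left _ (pos_of_mem_unitaryDivisors h)]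
  exact Nat.pos_of_ne_zero (right_ne_zero_of_mul h0)

theorem one_mem_unitaryDivisors {n : ℕ} (h : n ≠ 0) : 1 ∈ unitaryDivisors n :=
  mem_unitaryDivisors_iff.2 ⟨h, n, (one_mul n).symm, Nat.coprime_one_left n⟩

theorem self_mem_unitaryDivisors {n : ℕ} (h : n ≠ 0) : n ∈ unitaryDivisors n :=
  mem_unitaryDivisors_iff.2 ⟨h, 1, (mul_one n).symm, Nat.coprime_one_right n⟩

theorem unitaryDivisors_one : unitaryDivisors 1 = {1} := by
  ext d
  rw [Finset.mem_singleton]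
  exact ⟨fun h => Nat.dvd_one.1 (dvd_of_mem_unitaryDivisors h),
    fun h => h ▸ one_mem_unitaryDivisors one_ne_zero⟩

theorem unitaryDivisors_prime_pow {p : ℕ} (hp : p.Prime) (k : ℕ) :
    unitaryDivisors (p ^ k) = {1, p ^ k} := by
  have h0 : p ^ k ≠ 0 := pow_ne_zero _ hp.ne_zero
  ext d
  rw [Finset.mem_insert, Finset.mem_singleton]
  constructor
  · intro h
    obtain ⟨-, e, he, hc⟩ := mem_unitaryDivisors_iff.1 h
    obtain ⟨a, -, rfl⟩ := (Nat.dvd_prime_pow hp).1 (Dvd.intro e he.symm)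
    obtain ⟨b, -, rfl⟩ := (Nat.dvd_prime_pow hp).1 (Dvd.intro_left _ he.symm)
    rcases Nat.eq_zero_or_pos a with rfl | ha
    · exact Or.inl (pow_zero p)
    · rcases Nat.eq_zero_or_pos b with rfl | hb
      · right
        rw [he, pow_zero, mul_one]
      · rw [Nat.coprime_pow_left_iff ha, Nat.coprime_pow_right_iff hb, Nat.coprime_self] at hc
        exact absurd hc hp.ne_one
  · rintro (rfl | rfl)
    · exact one_mem_unitaryDivisors h0
    · exact self_mem_unitaryDivisors h0

theorem mul_mem_unitaryDivisors {m n a b : ℕ} (h : m.Coprime n) (ha : a ∈ unitaryDivisors m)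
    (hb : b ∈ unitaryDivisors n) : a * b ∈ unitaryDivisors (m * n) := by
  obtain ⟨hm, a', rfl, hca⟩ := mem_unitaryDivisors_iff.1 ha
  obtain ⟨hn, b', rfl, hcb⟩ := mem_unitaryDivisors_iff.1 hb
  refine mem_unitaryDivisors_iff.2 ⟨mul_ne_zero hm hn, a' * b', by ring, ?_⟩
  have h1 : a.Coprime b' := (h.coprime_mul_right).coprime_mul_left_right
  have h2 : a'.Coprime b := (h.coprime_mul_left).coprime_mul_right_right
  exact Nat.Coprime.mul_left (hca.mul_right h1) (h2.symm.mul_right hcb)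

theorem gcd_mem_unitaryDivisors {m n c : ℕ} (hc : c ∈ unitaryDivisors (m * n)) :
    c.gcd m ∈ unitaryDivisors m := by
  obtain ⟨h0, e, he, hce⟩ := mem_unitaryDivisors_iff.1 hc
  refine mem_unitaryDivisors_iff.2 ⟨left_ne_zero_of_mul h0, e.gcd m, ?_, ?_⟩
  -- As c and e are coprime, gcd(m, c) gcd(m, e) = gcd(m, ce) = gcd(m, mn) = m.
  · rw [Nat.gcd_comm c, Nat.gcd_comm e, ← hce.gcd_mul, ← he, Nat.gcd_mul_right_right]
  · exact (hce.coprime_dvd_left (Nat.gcd_dvd_left c m)).coprime_dvd_right (Nat.gcd_dvd_left e m)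

theorem gcd_mul_eq_left {m n a b : ℕ} (h : m.Coprime n) (ha : a ∣ m) (hb : b ∣ n) :
    (a * b).gcd m = a := by
  rw [Nat.Coprime.gcd_mul_right_cancel _ ((h.coprime_dvd_right hb).symm), Nat.gcd_eq_left ha]

/-- A sum over the unitary divisors of a product of coprime tuples. -/
theorem sum_unitaryDivisors_mul {r : ℕ} {m n : Fin r → ℕ} (h : ∀ i, (m i).Coprime (n i))
    (F : (Fin r → ℕ) → ℝ) :
    ∑ d ∈ Fintype.piFinset (fun i => unitaryDivisors (m i * n i)), F d =
      ∑ a ∈ Fintype.piFinset (fun i => unitaryDivisors (m i)),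
        ∑ b ∈ Fintype.piFinset (fun i => unitaryDivisors (n i)), F (fun i => a i * b i) := by
  rw [← Finset.sum_product']
  have key : ∀ d ∈ Fintype.piFinset (fun i => unitaryDivisors (m i * n i)),
      (fun i => (d i).gcd (m i) * (d i).gcd (n i)) = d := by
    intro d hd
    funext i
    rw [← (h i).gcd_mul]
    exact Nat.gcd_eq_left (dvd_of_mem_unitaryDivisors (Fintype.mem_piFinset.1 hd i))
  refine Finset.sum_bij' (fun d _ => (fun i => (d i).gcd (m i), fun i => (d i).gcd (n i)))
    (fun ab _ => fun i => ab.1 i * ab.2 i) ?_ ?_ ?_ ?_ ?_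
  · intro d hd
    rw [Fintype.mem_piFinset] at hd
    simp only [Finset.mem_product, Fintype.mem_piFinset]
    exact ⟨fun i => gcd_mem_unitaryDivisors (hd i),
      fun i => gcd_mem_unitaryDivisors (mul_comm (m i) (n i) ▸ hd i)⟩
  · rintro ⟨a, b⟩ hab
    simp only [Finset.mem_product, Fintype.mem_piFinset] at hab ⊢
    exact fun i => mul_mem_unitaryDivisors (h i) (hab.1 i) (hab.2 i)
  · exact fun d hd => key d hd
  · rintro ⟨a, b⟩ hab
    simp only [Finset.mem_product, Fintype.mem_piFinset] at hab
    ext i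
    · exact gcd_mul_eq_left (h i) (dvd_of_mem_unitaryDivisors (hab.1 i))
        (dvd_of_mem_unitaryDivisors (hab.2 i))
    · dsimp only
      rw [mul_comm]
      exact gcd_mul_eq_left (h i).symm (dvd_of_mem_unitaryDivisors (hab.2 i))
        (dvd_of_mem_unitaryDivisors (hab.1 i))
  · intro d hd
    dsimp only
    rw [key d hd]

/-! ### Multiplicativity of Q. -/

/-- The multiplicative functional equation, without the condition of not vanishing. -/
def MulOnCoprime {r : ℕ} (f : (Fin r → ℕ) → ℝ) : Prop :=
  ∀ m n : Fin r → ℕ, (∀ i, 0 < m i) → (∀ i, 0 < n i) →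
    Nat.gcd (∏ i, m i) (∏ i, n i) = 1 → f (fun i => m i * n i) = f m * f n

theorem gcd_prod_eq_one_iff {r : ℕ} {m n : Fin r → ℕ} :
    Nat.gcd (∏ i, m i) (∏ i, n i) = 1 ↔ ∀ i j, (m i).Coprime (n j) := by
  change Nat.Coprime _ _ ↔ _
  simp only [Nat.coprime_prod_left_iff, Nat.coprime_prod_right_iff, Finset.mem_univ,
    forall_true_left]
  exact forall_comm

theorem MulOnCoprime.unitaryConv {r : ℕ} {f g : (Fin r → ℕ) → ℝ} (hf : MulOnCoprime f)
    (hg : MulOnCoprime g) : MulOnCoprime (unitaryConv f g) := by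
  intro m n hm hn h
  rw [gcd_prod_eq_one_iff] at h
  unfold UnitaryDensity.unitaryConv
  rw [sum_unitaryDivisors_mul (fun i => h i i), Finset.sum_mul_sum]
  refine Finset.sum_congr rfl fun a ha => Finset.sum_congr rfl fun b hb => ?_
  rw [Fintype.mem_piFinset] at ha hb
  have hda := fun i => dvd_of_mem_unitaryDivisors (ha i)
  have hdb := fun i => dvd_of_mem_unitaryDivisors (hb i)
  have e : (fun i => m i * n i / (a i * b i)) = fun i => m i / a i * (n i / b i) :=
    funext fun i => Nat.mul_div_mul_comm (hda i) (hdb i)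
  rw [e, hf a b (fun i => pos_of_mem_unitaryDivisors (ha i))
    (fun i => pos_of_mem_unitaryDivisors (hb i)) (gcd_prod_eq_one_iff.2 fun i j =>
      ((h i j).coprime_dvd_left (hda i)).coprime_dvd_right (hdb j)),
    hg (fun i => m i / a i) (fun i => n i / b i)
    (fun i => div_pos_of_mem_unitaryDivisors (ha i))
    (fun i => div_pos_of_mem_unitaryDivisors (hb i)) (gcd_prod_eq_one_iff.2 fun i j =>
      ((h i j).coprime_dvd_left (Nat.div_dvd_of_dvd (hda i))).coprime_dvd_right
        (Nat.div_dvd_of_dvd (hdb j)))]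
  ring

theorem mulOnCoprime_unitaryMoebius (r : ℕ) : MulOnCoprime (unitaryMoebius r) := by
  intro m n hm hn h
  rw [gcd_prod_eq_one_iff] at h
  unfold unitaryMoebius
  rw [← pow_add, ← Finset.sum_add_distrib]
  congr 1
  refine Finset.sum_congr rfl fun i _ => ?_
  rw [(h i i).primeFactors_mul, Finset.card_union_of_disjoint (h i i).disjoint_primeFactors]

theorem factorization_eq_of_mem_unitaryDivisors {d n p : ℕ} (hd : d ∈ unitaryDivisors n)
    (hp : p.Prime) (hpd : p ∣ d) : n.factorization p = d.factorization p := by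
  obtain ⟨h0, e, rfl, hc⟩ := mem_unitaryDivisors_iff.1 hd
  have he : ¬ p ∣ e := fun hpe => hp.one_lt.ne' (Nat.dvd_one.1 (hc ▸ Nat.dvd_gcd hpd hpe))
  rw [Nat.factorization_mul (left_ne_zero_of_mul h0) (right_ne_zero_of_mul h0),
    Finsupp.add_apply, Nat.factorization_eq_zero_of_not_dvd he, add_zero]

/-- A unitary divisor of n that is divisible by p contains the full power of p in n, and that full
power is itself a unitary divisor. So a nontrivial common unitary divisor exists exactly when some
prime has the same positive exponent in a and b. -/
theorem gcud_eq_one_iff {a b : ℕ} (ha : 0 < a) (hb : 0 < b) :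
    gcud a b = 1 ↔ ∀ p, p.Prime → a.factorization p = b.factorization p →
      a.factorization p = 0 := by
  constructor
  · intro h p hp hab
    by_contra h0
    have key : ∀ c : ℕ, 0 < c → p ^ c.factorization p ∈ unitaryDivisors c := fun c hc =>
      mem_unitaryDivisors_iff.2 ⟨hc.ne', c / p ^ c.factorization p,
        (Nat.ordProj_mul_ordCompl_eq_self c p).symm,
        Nat.Coprime.pow_left _ (Nat.coprime_ordCompl hp hc.ne')⟩
    have hle : p ^ a.factorization p ≤ gcud a b :=
      Finset.le_sup (f := id) (Finset.mem_inter.2 ⟨key a ha, hab ▸ key b hb⟩)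
    rw [h] at hle
    exact absurd hle (not_le.2 (Nat.one_lt_pow h0 hp.one_lt))
  · intro h
    have h1 : ∀ d ∈ unitaryDivisors a ∩ unitaryDivisors b, d = 1 := by
      intro d hd
      rw [Finset.mem_inter] at hd
      by_contra hd1
      obtain ⟨p, hp, hpd⟩ := Nat.exists_prime_and_dvd hd1
      have ea := factorization_eq_of_mem_unitaryDivisors hd.1 hp hpd
      have eb := factorization_eq_of_mem_unitaryDivisors hd.2 hp hpd
      have := h p hp (ea.trans eb.symm)
      exact (hp.factorization_pos_of_dvd (pos_of_mem_unitaryDivisors hd.1).ne' hpd).ne'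
        (ea ▸ this)
    refine le_antisymm (Finset.sup_le fun d hd => (h1 d hd).le) ?_
    exact Finset.le_sup (f := id) (Finset.mem_inter.2
      ⟨one_mem_unitaryDivisors ha.ne', one_mem_unitaryDivisors hb.ne'⟩)

/-- No prime has the same positive exponent in two coordinates. -/
theorem mem_pairwiseUnitaryCoprime_iff {r : ℕ} {n : Fin r → ℕ} (hn : ∀ i, 0 < n i) :
    n ∈ pairwiseUnitaryCoprime r ↔ ∀ p, p.Prime → ∀ i j, i ≠ j →
      (n i).factorization p = (n j).factorization p → (n i).factorization p = 0 := by
  unfold pairwiseUnitaryCoprime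
  constructor
  · intro h p hp i j hij
    exact (gcud_eq_one_iff (hn i) (hn j)).1 (h.2 i j hij) p hp
  · intro h
    exact ⟨hn, fun i j hij => (gcud_eq_one_iff (hn i) (hn j)).2 fun p hp => h p hp i j hij⟩

theorem mul_mem_pairwiseUnitaryCoprime_iff {r : ℕ} {m n : Fin r → ℕ} (hm : ∀ i, 0 < m i)
    (hn : ∀ i, 0 < n i) (h : ∀ i j, (m i).Coprime (n j)) :
    (fun i => m i * n i) ∈ pairwiseUnitaryCoprime r ↔
      m ∈ pairwiseUnitaryCoprime r ∧ n ∈ pairwiseUnitaryCoprime r := by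
  rw [mem_pairwiseUnitaryCoprime_iff hm, mem_pairwiseUnitaryCoprime_iff hn,
    mem_pairwiseUnitaryCoprime_iff (fun i => Nat.mul_pos (hm i) (hn i)), ← forall_and]
  refine forall_congr' fun p => ?_
  rw [← imp_and]
  refine imp_congr_right fun hp => ?_
  have e : ∀ i, (m i * n i).factorization p = (m i).factorization p + (n i).factorization p :=
    fun i => by rw [Nat.factorization_mul (hm i).ne' (hn i).ne', Finsupp.add_apply]
  -- No prime divides both some mᵢ and some nⱼ, so at p one of the two tuples has only zero
  -- exponents and the condition concerns the other one alone.
  have z : (∀ i, (m i).factorization p = 0) ∨ ∀ i, (n i).factorization p = 0 := by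
    by_contra! hcon
    obtain ⟨⟨i, hi⟩, j, hj⟩ := hcon
    exact hp.one_lt.ne' (Nat.dvd_one.1 (h i j ▸ Nat.dvd_gcd (Nat.dvd_of_factorization_pos hi)
      (Nat.dvd_of_factorization_pos hj)))
  simp only [e]
  rcases z with z | z <;> simp [z]

theorem mulOnCoprime_rhoUnitary (r : ℕ) : MulOnCoprime (rhoUnitary r) := by
  intro m n hm hn h
  rw [gcd_prod_eq_one_iff] at h
  unfold rhoUnitary
  have := mul_mem_pairwiseUnitaryCoprime_iff hm hn h
  classical
  simp only [Set.indicator_apply, this, Pi.one_apply]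
  by_cases h1 : m ∈ pairwiseUnitaryCoprime r <;> by_cases h2 : n ∈ pairwiseUnitaryCoprime r <;>
    simp [h1, h2]

theorem one_mem_pairwiseUnitaryCoprime (r : ℕ) : (fun _ => 1) ∈ pairwiseUnitaryCoprime r :=
  (mem_pairwiseUnitaryCoprime_iff fun _ => one_pos).2 (by simp)

theorem mulOnCoprime_Q (r : ℕ) : MulOnCoprime (Q r) :=
  (mulOnCoprime_unitaryMoebius r).unitaryConv (mulOnCoprime_rhoUnitary r)

theorem Q_one (r : ℕ) : Q r (fun _ => 1) = 1 := by
  unfold Q unitaryConv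
  simp only [unitaryDivisors_one, Fintype.piFinset_singleton, Finset.sum_singleton]
  simp [unitaryMoebius, rhoUnitary, one_mem_pairwiseUnitaryCoprime]

theorem isMultiplicative_Q (r : ℕ) : IsMultiplicative (Q r) :=
  ⟨⟨fun _ => 1, fun _ => one_pos, by rw [Q_one]; exact one_ne_zero⟩, mulOnCoprime_Q r⟩

/-- `unitaryDivisors 0` is empty. This lets the series run over all of `Fin r → ℕ` with no
contribution from tuples that have a zero coordinate. -/
theorem Q_eq_zero_of_not_pos {r : ℕ} {n : Fin r → ℕ} (h : ¬ ∀ i, 0 < n i) : Q r n = 0 := by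
  push Not at h
  obtain ⟨i, hi⟩ := h
  unfold Q unitaryConv
  refine Finset.sum_eq_zero fun d hd => ?_
  exact absurd (Nat.le_zero.1 hi) (mem_unitaryDivisors_iff.1 (Fintype.mem_piFinset.1 hd i)).1

/-! ### Möbius inversion for the unitary convolution. -/

/-- The unitary Möbius function sums to zero over the unitary divisors of `n ≠ 1`. -/
theorem sum_unitaryDivisors_neg_one_pow {n : ℕ} (hn : n ≠ 0) :
    ∑ d ∈ unitaryDivisors n, (-1 : ℝ) ^ d.primeFactors.card = if n = 1 then 1 else 0 := by
  split_ifs with h1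
  · subst h1
    simp [unitaryDivisors_one]
  · obtain ⟨p, hp, hpn⟩ := Nat.exists_prime_and_dvd h1
    set k := n.factorization p with hk
    have hk0 : k ≠ 0 := (hp.factorization_pos_of_dvd hn hpn).ne'
    have e : p ^ k * (n / p ^ k) = n := Nat.ordProj_mul_ordCompl_eq_self n p
    have hc : (p ^ k).Coprime (n / p ^ k) := Nat.Coprime.pow_left _ (Nat.coprime_ordCompl hp hn)
    -- Splitting off the full power of one prime p pairs each divisor b prime to p with p ^ k * b;
    -- the two have opposite signs.
    have key := sum_unitaryDivisors_mul (r := 1) (m := fun _ => p ^ k) (n := fun _ => n / p ^ k)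
      (fun _ => hc) (fun d => (-1 : ℝ) ^ (d 0).primeFactors.card)
    have conv : ∀ (s : Finset ℕ) (F : ℕ → ℝ),
        ∑ d ∈ Fintype.piFinset (fun _ : Fin 1 => s), F (d 0) = ∑ d ∈ s, F d := by
      intro s F
      refine Finset.sum_bij' (fun d _ => d 0) (fun a _ _ => a) ?_ ?_ ?_ ?_ ?_
      · exact fun d hd => Fintype.mem_piFinset.1 hd 0
      · exact fun a ha => Fintype.mem_piFinset.2 fun _ => ha
      · exact fun d _ => funext fun i => by rw [Subsingleton.elim i 0]
      · exact fun _ _ => rfl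
      · exact fun _ _ => rfl
    simp only [e] at key
    rw [conv _ fun d => (-1 : ℝ) ^ d.primeFactors.card] at key
    rw [key, conv _ fun a => ∑ b ∈ Fintype.piFinset (fun _ : Fin 1 => unitaryDivisors (n / p ^ k)),
      (-1 : ℝ) ^ (a * b 0).primeFactors.card, unitaryDivisors_prime_pow hp,
      Finset.sum_pair (Nat.one_lt_pow hk0 hp.one_lt).ne, ← Finset.sum_add_distrib]
    refine Finset.sum_eq_zero fun b hb => ?_
    have hb' := dvd_of_mem_unitaryDivisors (Fintype.mem_piFinset.1 hb 0)
    have hcb := hc.coprime_dvd_right hb'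
    rw [hcb.primeFactors_mul, Finset.card_union_of_disjoint hcb.disjoint_primeFactors,
      Nat.primeFactors_prime_pow hk0 hp, one_mul, Finset.card_singleton, pow_add]
    ring

/-- Together with `mul_mem_unitaryDivisors_of_div` this gives the bijection (e, d) ↦ (e / d, d) from
chains d ∥ e ∥ n to pairs f ∥ n, d ∥ n / f, which is what associativity of the convolution amounts
to here. -/
theorem div_mem_unitaryDivisors {n e d : ℕ} (he : e ∈ unitaryDivisors n)
    (hd : d ∈ unitaryDivisors e) :
    e / d ∈ unitaryDivisors n ∧ d ∈ unitaryDivisors (n / (e / d)) := by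
  have hd0 := pos_of_mem_unitaryDivisors hd
  obtain ⟨h0, k, rfl, hek⟩ := mem_unitaryDivisors_iff.1 he
  obtain ⟨h1, f, rfl, hdf⟩ := mem_unitaryDivisors_iff.1 hd
  have hf0 : 0 < f := Nat.pos_of_ne_zero (right_ne_zero_of_mul h1)
  rw [Nat.mul_div_cancel_left _ hd0]
  have e1 : d * f * k = f * (d * k) := by ring
  refine ⟨mem_unitaryDivisors_iff.2 ⟨h0, d * k, e1, ?_⟩, ?_⟩
  · exact hdf.symm.mul_right hek.coprime_mul_left
  · rw [e1, Nat.mul_div_cancel_left _ hf0]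
    exact mem_unitaryDivisors_iff.2
      ⟨mul_ne_zero hd0.ne' (right_ne_zero_of_mul h0), k, rfl, hek.coprime_mul_right⟩

theorem mul_mem_unitaryDivisors_of_div {n f d : ℕ} (hf : f ∈ unitaryDivisors n)
    (hd : d ∈ unitaryDivisors (n / f)) :
    f * d ∈ unitaryDivisors n ∧ d ∈ unitaryDivisors (f * d) := by
  have hf0 := pos_of_mem_unitaryDivisors hf
  have hd0 := pos_of_mem_unitaryDivisors hd
  obtain ⟨h0, g, rfl, hfg⟩ := mem_unitaryDivisors_iff.1 hf
  rw [Nat.mul_div_cancel_left _ hf0] at hd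
  obtain ⟨h1, k, rfl, hdk⟩ := mem_unitaryDivisors_iff.1 hd
  refine ⟨mem_unitaryDivisors_iff.2 ⟨h0, k, by ring, ?_⟩, ?_⟩
  · exact hfg.coprime_mul_left_right.mul_left hdk
  · exact mem_unitaryDivisors_iff.2
      ⟨mul_ne_zero hf0.ne' hd0.ne', f, mul_comm _ _, hfg.coprime_mul_right_right.symm⟩

theorem sum_unitaryMoebius {r : ℕ} {n : Fin r → ℕ} (hn : ∀ i, n i ≠ 0) :
    ∑ d ∈ Fintype.piFinset (fun i => unitaryDivisors (n i)), unitaryMoebius r d =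
      if n = fun _ => 1 then 1 else 0 := by
  have e : ∀ d : Fin r → ℕ,
      unitaryMoebius r d = ∏ i, (-1 : ℝ) ^ (d i).primeFactors.card := fun d =>
    (Finset.prod_pow_eq_pow_sum _ _ _).symm
  simp only [e]
  rw [← Finset.prod_univ_sum (fun i => unitaryDivisors (n i))
    fun _ d => (-1 : ℝ) ^ d.primeFactors.card]
  simp only [sum_unitaryDivisors_neg_one_pow (hn _)]
  rw [Finset.prod_ite_zero]
  simp [funext_iff]

/-- Möbius inversion for the unitary convolution: `rhoUnitary` is the sum of `Q` over the unitary
divisors. -/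
theorem sum_Q_unitaryDivisors {r : ℕ} {n : Fin r → ℕ} (hn : ∀ i, n i ≠ 0) :
    ∑ e ∈ Fintype.piFinset (fun i => unitaryDivisors (n i)), Q r e = rhoUnitary r n := by
  have h1 : ∑ e ∈ Fintype.piFinset (fun i => unitaryDivisors (n i)), Q r e =
      ∑ f ∈ Fintype.piFinset (fun i => unitaryDivisors (n i)),
        ∑ d ∈ Fintype.piFinset (fun i => unitaryDivisors (n i / f i)),
          unitaryMoebius r d * rhoUnitary r f := by
    unfold Q unitaryConv
    rw [Finset.sum_sigma', Finset.sum_sigma']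
    refine Finset.sum_bij' (fun x _ => ⟨fun i => x.1 i / x.2 i, x.2⟩)
      (fun x _ => ⟨fun i => x.1 i * x.2 i, x.2⟩) ?_ ?_ ?_ ?_ ?_
    · rintro ⟨e, d⟩ h
      simp only [Finset.mem_sigma, Fintype.mem_piFinset] at h ⊢
      exact ⟨fun i => (div_mem_unitaryDivisors (h.1 i) (h.2 i)).1,
        fun i => (div_mem_unitaryDivisors (h.1 i) (h.2 i)).2⟩
    · rintro ⟨f, d⟩ h
      simp only [Finset.mem_sigma, Fintype.mem_piFinset] at h ⊢
      exact ⟨fun i => (mul_mem_unitaryDivisors_of_div (h.1 i) (h.2 i)).1,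
        fun i => (mul_mem_unitaryDivisors_of_div (h.1 i) (h.2 i)).2⟩
    · rintro ⟨e, d⟩ h
      simp only [Finset.mem_sigma, Fintype.mem_piFinset] at h ⊢
      congr 1
      funext i
      exact Nat.div_mul_cancel (dvd_of_mem_unitaryDivisors (h.2 i))
    · rintro ⟨f, d⟩ h
      simp only [Finset.mem_sigma, Fintype.mem_piFinset] at h ⊢
      congr 1
      funext i
      exact Nat.mul_div_cancel _ (pos_of_mem_unitaryDivisors (h.2 i))
    · exact fun _ _ => rfl
  have hself : n ∈ Fintype.piFinset (fun i => unitaryDivisors (n i)) :=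
    Fintype.mem_piFinset.2 fun i => self_mem_unitaryDivisors (hn i)
  -- The inner Möbius sum vanishes unless every nᵢ / fᵢ is 1, so only f = n survives.
  rw [h1, Finset.sum_eq_single_of_mem n hself]
  · rw [← Finset.sum_mul, sum_unitaryMoebius, if_pos, one_mul]
    · exact funext fun i => Nat.div_self (Nat.pos_of_ne_zero (hn i))
    · exact fun i => by rw [Nat.div_self (Nat.pos_of_ne_zero (hn i))]; exact one_ne_zero
  · intro f hf hfn
    rw [Fintype.mem_piFinset] at hf
    rw [← Finset.sum_mul, sum_unitaryMoebius fun i => (div_pos_of_mem_unitaryDivisors (hf i)).ne',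
      if_neg, zero_mul]
    intro h
    refine hfn (funext fun i => ?_)
    exact Nat.eq_of_dvd_of_div_eq_one (dvd_of_mem_unitaryDivisors (hf i)) (congrFun h i)

/-! ### Values of Q at powers of a prime, and their bounds. -/

theorem sum_powerset_union_of_disjoint {α M : Type*} [DecidableEq α] [AddCommMonoid M]
    {s t : Finset α} (h : Disjoint s t) (F : Finset α → M) :
    ∑ J ∈ (s ∪ t).powerset, F J = ∑ A ∈ s.powerset, ∑ B ∈ t.powerset, F (A ∪ B) := by
  rw [← Finset.sum_product']
  have hd : ∀ {a}, a ∈ s → a ∉ t := fun ha => Finset.disjoint_left.1 h ha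
  refine Finset.sum_bij' (fun J _ => (J ∩ s, J ∩ t)) (fun AB _ => AB.1 ∪ AB.2) ?_ ?_ ?_ ?_ ?_
  · intro J _
    simp
  · rintro ⟨A, B⟩ hAB
    simp only [Finset.mem_product, Finset.mem_powerset] at hAB ⊢
    exact Finset.union_subset_union hAB.1 hAB.2
  · intro J hJ
    dsimp only
    rw [← Finset.inter_union_distrib_left, Finset.inter_eq_left.2 (Finset.mem_powerset.1 hJ)]
  · rintro ⟨A, B⟩ hAB
    simp only [Finset.mem_product, Finset.mem_powerset] at hAB
    ext x
    · have h1 := @hAB.1 x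
      have h2 := @hAB.2 x
      have h3 := @hd x
      simp only [Finset.mem_inter, Finset.mem_union]
      tauto
    · have h1 := @hAB.1 x
      have h2 := @hAB.2 x
      have h3 := @hd x
      simp only [Finset.mem_inter, Finset.mem_union]
      tauto
  · intro J hJ
    dsimp only
    rw [← Finset.inter_union_distrib_left, Finset.inter_eq_left.2 (Finset.mem_powerset.1 hJ)]

open Classical in
-- On a fibre of ν, injectivity leaves only the empty set, contributing 1, and the singletons,
-- contributing -1 each.
theorem sum_powerset_injOn_of_const {ι : Type*} (ν : ι → ℕ) (v : ℕ) (C : Finset ι)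
    (hC : ∀ i ∈ C, ν i = v) :
    ∑ J ∈ C.powerset, (if Set.InjOn ν (J : Set ι) then (-1 : ℝ) ^ J.card else 0) =
      1 - (C.card : ℝ) := by
  induction C using Finset.induction_on with
  | empty => simp
  | insert x C hx ih =>
    rw [Finset.sum_powerset_insert hx, ih fun i hi => hC i (Finset.mem_insert_of_mem hi),
      Finset.sum_eq_single_of_mem ∅ (Finset.empty_mem_powerset C), Finset.card_insert_of_notMem hx]
    · simp
      ring
    · intro J hJ hne
      obtain ⟨y, hy⟩ := Finset.nonempty_iff_ne_empty.2 hne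
      have hyC := Finset.mem_powerset.1 hJ hy
      refine if_neg fun hinj => hx ?_
      have : x = y := hinj (by simp) (by simp [hy])
        ((hC x (Finset.mem_insert_self x C)).trans (hC y (Finset.mem_insert_of_mem hyC)).symm)
      exact this ▸ hyC

open Classical in
/-- The signed count of the partial transversals of the fibres of `ν` over `V`. -/
theorem sum_powerset_injOn {ι : Type*} [Fintype ι] (ν : ι → ℕ) (V : Finset ℕ) :
    ∑ J ∈ (Finset.univ.filter fun i => ν i ∈ V).powerset,
        (if Set.InjOn ν (J : Set ι) then (-1 : ℝ) ^ J.card else 0) =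
      ∏ v ∈ V, (1 - ((Finset.univ.filter fun i => ν i = v).card : ℝ)) := by
  induction V using Finset.induction_on with
  | empty => simp
  | insert v V hv ih =>
    have e : (Finset.univ.filter fun i => ν i ∈ insert v V) =
        (Finset.univ.filter fun i => ν i = v) ∪ Finset.univ.filter fun i => ν i ∈ V := by
      ext i
      simp
    have hdis : Disjoint (Finset.univ.filter fun i => ν i = v)
        (Finset.univ.filter fun i => ν i ∈ V) := by
      rw [Finset.disjoint_left]
      intro i hi hi'
      simp only [Finset.mem_filter, Finset.mem_univ, true_and] at hi hi'
      exact hv (hi ▸ hi')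
    rw [e, sum_powerset_union_of_disjoint hdis, Finset.prod_insert hv, ← ih,
      ← sum_powerset_injOn_of_const ν v (Finset.univ.filter fun i => ν i = v)
        (fun i hi => (Finset.mem_filter.1 hi).2), Finset.sum_mul_sum]
    refine Finset.sum_congr rfl fun A hA => Finset.sum_congr rfl fun B hB => ?_
    rw [Finset.mem_powerset] at hA hB
    have hAB : Disjoint A B := Finset.disjoint_of_subset_left hA
      (Finset.disjoint_of_subset_right hB hdis)
    -- ν takes the value v on A and values in V on B; as v ∉ V, no collision between A and B is
    -- possible.
    have hinj : Set.InjOn ν ((A ∪ B : Finset ι) : Set ι) ↔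
        Set.InjOn ν (A : Set ι) ∧ Set.InjOn ν (B : Set ι) := by
      rw [Finset.coe_union, Set.injOn_union (Finset.disjoint_coe.2 hAB)]
      refine ⟨fun h => ⟨h.1, h.2.1⟩, fun h => ⟨h.1, h.2, fun a ha b hb hab => hv ?_⟩⟩
      have h1 := (Finset.mem_filter.1 (hA ha)).2
      have h2 := (Finset.mem_filter.1 (hB hb)).2
      rwa [← hab, h1] at h2
    rw [Finset.card_union_of_disjoint hAB, pow_add]
    simp only [hinj]
    split_ifs <;> simp_all

theorem card_primeFactors_prime_pow {p : ℕ} (hp : p.Prime) (k : ℕ) :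
    (p ^ k).primeFactors.card = if 0 < k then 1 else 0 := by
  split_ifs with h
  · rw [Nat.primeFactors_prime_pow h.ne' hp, Finset.card_singleton]
  · rw [Nat.eq_zero_of_not_pos h]
    simp

open Classical in
theorem rhoUnitary_prime_pow {r p : ℕ} (hp : p.Prime) (ν : Fin r → ℕ) (J : Finset (Fin r))
    (hJ : ∀ i ∈ J, 0 < ν i) :
    rhoUnitary r (fun i => if i ∈ J then p ^ ν i else 1) =
      if Set.InjOn ν (J : Set (Fin r)) then 1 else 0 := by
  unfold rhoUnitary
  rw [Set.indicator_apply]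
  refine if_congr ?_ rfl rfl
  have hpos : ∀ i, 0 < (if i ∈ J then p ^ ν i else 1) := fun i => by
    split_ifs
    · exact pow_pos hp.pos _
    · exact one_pos
  rw [mem_pairwiseUnitaryCoprime_iff hpos]
  have e : ∀ q i, (if i ∈ J then p ^ ν i else 1).factorization q =
      if i ∈ J ∧ q = p then ν i else 0 := by
    intro q i
    by_cases hi : i ∈ J
    · by_cases hq : q = p
      · subst hq
        simp [hi, hp.factorization_pow]
      · simp [hi, hq, hp.factorization_pow]
    · simp [hi]
  simp only [e]
  constructor
  · intro h i hi j hj hij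
    by_contra hne
    have := h p hp i j hne
    rw [if_pos ⟨hi, rfl⟩, if_pos ⟨hj, rfl⟩] at this
    exact (hJ i hi).ne' (this hij)
  · intro h q hq i j hij heq
    by_contra hne
    have hi : i ∈ J ∧ q = p := by
      by_contra hc
      exact hne (if_neg hc)
    rw [if_pos hi] at heq hne
    have hj : j ∈ J ∧ q = p := by
      by_contra hc
      rw [if_neg hc] at heq
      exact hne heq
    rw [if_pos hj] at heq
    exact hij (h hi.1 hj.1 heq)

open Classical in
-- In each coordinate dᵢ is 1 or p ^ νᵢ. Let J be the set of i with νᵢ > 0 and dᵢ = 1; restricting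
-- to positive νᵢ makes d ↔ J bijective, since for νᵢ = 0 both choices coincide. The quotient keeps
-- p ^ νᵢ exactly on J, so `rhoUnitary` tests injectivity of ν on J, while the Möbius sign comes
-- from the other positive exponents and is (-1)^(|W| - |J|) = (-1)^|W| (-1)^|J|.
theorem Q_prime_pow_eq_sum {r p : ℕ} (hp : p.Prime) (ν : Fin r → ℕ) :
    Q r (fun i => p ^ ν i) = (-1) ^ (Finset.univ.filter fun i => 0 < ν i).card *
      ∑ J ∈ (Finset.univ.filter fun i => 0 < ν i).powerset,
        (if Set.InjOn ν (J : Set (Fin r)) then (-1 : ℝ) ^ J.card else 0) := by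
  set W := Finset.univ.filter fun i => 0 < ν i with hW
  have memW : ∀ i, i ∈ W ↔ 0 < ν i := fun i => by simp [hW]
  unfold Q unitaryConv
  rw [Finset.mul_sum]
  refine Finset.sum_bij' (fun d _ => W.filter fun i => d i = 1)
    (fun J _ => fun i => if i ∈ J then 1 else p ^ ν i) ?_ ?_ ?_ ?_ ?_
  · intro d _
    exact Finset.mem_powerset.2 (Finset.filter_subset _ _)
  · intro J _
    rw [Fintype.mem_piFinset]
    intro i
    rw [unitaryDivisors_prime_pow hp]
    split_ifs <;> simp
  · intro d hd
    rw [Fintype.mem_piFinset] at hd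
    funext i
    have hdi := hd i
    rw [unitaryDivisors_prime_pow hp, Finset.mem_insert, Finset.mem_singleton] at hdi
    split_ifs with h
    · exact (Finset.mem_filter.1 h).2.symm
    · rcases hdi with h1 | h1
      · have : ¬ 0 < ν i := fun h0 => h (Finset.mem_filter.2 ⟨(memW i).2 h0, h1⟩)
        rw [Nat.eq_zero_of_not_pos this, pow_zero, h1]
      · exact h1.symm
  · intro J hJ
    ext i
    have := fun hi => (memW i).1 (Finset.mem_powerset.1 hJ hi)
    simp only [Finset.mem_filter, memW]
    constructor
    · rintro ⟨h0, h1⟩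
      by_contra hi
      rw [if_neg hi] at h1
      exact (Nat.one_lt_pow h0.ne' hp.one_lt).ne' h1
    · exact fun hi => ⟨this hi, if_pos hi⟩
  · intro d hd
    rw [Fintype.mem_piFinset] at hd
    simp only [unitaryDivisors_prime_pow hp, Finset.mem_insert, Finset.mem_singleton] at hd
    set J := W.filter fun i => d i = 1 with hJ
    have memJ : ∀ i, i ∈ J ↔ 0 < ν i ∧ d i = 1 := fun i => by rw [hJ, Finset.mem_filter, memW]
    have hJW : J ⊆ W := Finset.filter_subset _ _
    have e1 : (fun i => p ^ ν i / d i) = fun i => if i ∈ J then p ^ ν i else 1 := by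
      funext i
      split_ifs with h
      · rw [((memJ i).1 h).2, Nat.div_one]
      · rcases hd i with h1 | h1
        · have : ¬ 0 < ν i := fun h0 => h ((memJ i).2 ⟨h0, h1⟩)
          rw [h1, Nat.eq_zero_of_not_pos this, pow_zero, Nat.div_one]
        · rw [h1, Nat.div_self (pow_pos hp.pos _)]
    have e2 : unitaryMoebius r d = (-1) ^ (W \ J).card := by
      unfold unitaryMoebius
      congr 1
      rw [Finset.card_eq_sum_ones, ← Finset.sum_filter_add_sum_filter_not Finset.univ (· ∈ W \ J),
        Finset.filter_mem_eq_inter, Finset.univ_inter]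
      have z : ∑ i with i ∉ W \ J, (d i).primeFactors.card = 0 := by
        refine Finset.sum_eq_zero fun i hi => ?_
        have hi' := (Finset.mem_filter.1 hi).2
        rw [Finset.mem_sdiff, not_and_not_right, memW, memJ] at hi'
        rcases hd i with h1 | h1
        · simp [h1]
        · by_cases h0 : 0 < ν i
          · simp [(hi' h0).2]
          · rw [h1, Nat.eq_zero_of_not_pos h0]
            simp
      rw [z, add_zero]
      refine Finset.sum_congr rfl fun i hi => ?_
      rw [Finset.mem_sdiff, memW, memJ] at hi
      rcases hd i with h1 | h1
      · exact absurd ⟨hi.1, h1⟩ hi.2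
      · rw [h1, card_primeFactors_prime_pow hp, if_pos hi.1]
    rw [e1, e2, rhoUnitary_prime_pow hp ν J fun i hi => ((memJ i).1 hi).1,
      ← Finset.card_sdiff_add_card_eq_card hJW, pow_add]
    have sq : ((-1 : ℝ) ^ J.card) * (-1) ^ J.card = 1 := by
      rw [← mul_pow]
      simp
    split_ifs
    · rw [mul_assoc, sq]
    · simp

theorem filter_mem_positiveValues {r : ℕ} (ν : Fin r → ℕ) :
    (Finset.univ.filter fun i => ν i ∈ positiveValues ν) =
      Finset.univ.filter fun i => 0 < ν i := by
  ext i
  simp [positiveValues]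

/-- The values of `Q` at powers of a prime. -/
theorem Q_prime_pow {r p : ℕ} (hp : p.Prime) (ν : Fin r → ℕ) :
    Q r (fun i => p ^ ν i) =
      (-1) ^ (∑ v ∈ positiveValues ν, multiplicity ν v) *
        ∏ v ∈ positiveValues ν, (1 - (multiplicity ν v : ℝ)) := by
  classical
  rw [Q_prime_pow_eq_sum hp]
  congr 2
  · rw [Finset.card_eq_sum_card_fiberwise (f := ν) (t := positiveValues ν)]
    · refine Finset.sum_congr rfl fun v hv => ?_
      unfold multiplicity
      congr 1
      ext i
      have := (Finset.mem_filter.1 hv).2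
      simp only [Finset.mem_filter, Finset.mem_univ, true_and, and_iff_right_iff_imp]
      exact fun h => h ▸ this
    · intro i hi
      rw [← filter_mem_positiveValues] at hi
      exact (Finset.mem_filter.1 hi).2
  · rw [← filter_mem_positiveValues, sum_powerset_injOn]
    rfl

/-- There are at most r factors 1 - t, each with 0 ≤ t ≤ r. Only uniformity in p and ν matters. -/
theorem abs_Q_prime_pow_le {r p : ℕ} (hr : 1 ≤ r) (hp : p.Prime) (ν : Fin r → ℕ) :
    |Q r (fun i => p ^ ν i)| ≤ (r : ℝ) ^ r := by
  have hr' : (1 : ℝ) ≤ r := by exact_mod_cast hr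
  rw [Q_prime_pow hp, abs_mul, abs_pow, abs_neg, abs_one, one_pow, one_mul, Finset.abs_prod]
  have hcard : (positiveValues ν).card ≤ r :=
    (Finset.card_filter_le _ _).trans (Finset.card_image_le.trans (by simp))
  refine (Finset.prod_le_prod (g := fun _ => (r : ℝ)) (fun _ _ => abs_nonneg _)
    fun v hv => ?_).trans ((Finset.prod_const _).trans_le (pow_le_pow_right₀ hr' hcard))
  have h : multiplicity ν v ≤ r := (Finset.card_filter_le _ _).trans (by simp)
  have h' : (multiplicity ν v : ℝ) ≤ r := by exact_mod_cast h
  have h0 : (0 : ℝ) ≤ multiplicity ν v := Nat.cast_nonneg _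
  rw [abs_le]
  constructor <;> linarith

/-- `Q` vanishes at `(p ^ ν₁, …, p ^ νᵣ)` if exactly one positive exponent `νᵢ = 1` occurs. -/
theorem Q_prime_pow_eq_zero {r p : ℕ} (hp : p.Prime) (ν : Fin r → ℕ) (h : ∑ i, ν i = 1) :
    Q r (fun i => p ^ ν i) = 0 := by
  obtain ⟨i, -, hi⟩ : ∃ i ∈ Finset.univ, ν i ≠ 0 := by
    refine Finset.exists_ne_zero_of_sum_ne_zero ?_
    rw [h]
    exact one_ne_zero
  -- A second index with the same positive exponent would force the sum of the exponents to be at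
  -- least 2.
  have key : ∀ j, ν j = ν i → j = i := by
    intro j hj
    by_contra hji
    have := Finset.sum_le_sum_of_subset (f := ν) (Finset.subset_univ {j, i})
    rw [Finset.sum_pair hji, h] at this
    omega
  rw [Q_prime_pow hp, Finset.prod_eq_zero (i := ν i), mul_zero]
  · exact Finset.mem_filter.2 ⟨Finset.mem_image_of_mem _ (Finset.mem_univ i), Nat.pos_of_ne_zero hi⟩
  · have : (Finset.univ.filter fun j => ν j = ν i) = {i} := by
      ext j
      simp only [Finset.mem_filter, Finset.mem_univ, true_and, Finset.mem_singleton]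
      exact ⟨key j, fun h => h ▸ rfl⟩
    simp [multiplicity, this]

/-- A majorant for the Euler factors at all primes at once; a finite set of tuples lies in a cube,
where the sum is a product of r partial geometric sums. -/
theorem summable_prod_half_pow (r : ℕ) : Summable fun ν : Fin r → ℕ => ∏ i, (1 / 2 : ℝ) ^ ν i := by
  refine summable_of_sum_le (c := ∏ _i : Fin r, 2) (fun ν => by positivity) fun s => ?_
  obtain ⟨N, hN⟩ : ∃ N : ℕ, ∀ ν ∈ s, ∀ i, ν i < N := by
    refine ⟨(s.sup fun ν => ∑ i, ν i) + 1, fun ν hν i => Nat.lt_succ_of_le ?_⟩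
    exact (Finset.single_le_sum (fun _ _ => Nat.zero_le _) (Finset.mem_univ i)).trans
      (Finset.le_sup (f := fun ν : Fin r → ℕ => ∑ i, ν i) hν)
  calc ∑ ν ∈ s, ∏ i, (1 / 2 : ℝ) ^ ν i
      ≤ ∑ ν ∈ Fintype.piFinset (fun _ : Fin r => Finset.range N), ∏ i, (1 / 2 : ℝ) ^ ν i := by
        refine Finset.sum_le_sum_of_subset_of_nonneg (fun ν hν => ?_) fun _ _ _ => by positivity
        exact Fintype.mem_piFinset.2 fun i => Finset.mem_range.2 (hN ν hν i)
    _ = ∏ _i : Fin r, ∑ k ∈ Finset.range N, (1 / 2 : ℝ) ^ k :=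
        (Finset.prod_univ_sum (fun _ => Finset.range N) fun _ k => (1 / 2 : ℝ) ^ k).symm
    _ ≤ ∏ _i : Fin r, 2 := by
        refine Finset.prod_le_prod (fun _ _ => Finset.sum_nonneg fun _ _ => by positivity)
          fun _ _ => ?_
        exact sum_geometric_two_le N

/-! ### Encoding of tuples by single integers. -/

/-- The normalization at 0 ensures that primes not dividing the code do not divide the decoded tuple
either. -/
theorem exists_equiv_nat {r : ℕ} (hr : 1 ≤ r) : ∃ e : (Fin r → ℕ) ≃ ℕ, e.symm 0 = 0 := by
  have : Nonempty (Fin r) := ⟨⟨0, hr⟩⟩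
  obtain ⟨e⟩ := nonempty_equiv_of_countable (α := Fin r → ℕ) (β := ℕ)
  refine ⟨e.trans (Equiv.swap (e 0) 0), ?_⟩
  simp

/-- A tuple of natural numbers is encoded by one natural number, whose exponent at every prime
encodes the tuple of exponents; this is the inverse map. -/
noncomputable def decodeTuple {r : ℕ} (e : (Fin r → ℕ) ≃ ℕ) (he : e.symm 0 = 0) (m : ℕ) :
    Fin r → ℕ := fun i =>
  -- The zero tuple is not a tuple of positive integers, so for r ≥ 1 the map stays injective, and a
  -- function supported on positive tuples pulls back to one vanishing at 0.
  if m = 0 then 0 else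
    (m.factorization.mapRange (fun k => e.symm k i) (congrFun he i)).prod (· ^ ·)

section decode

variable {r : ℕ} {e : (Fin r → ℕ) ≃ ℕ} {he : e.symm 0 = 0}

theorem decodeTuple_zero : decodeTuple e he 0 = 0 := funext fun _ => if_pos rfl

theorem factorization_decodeTuple {m : ℕ} (hm : m ≠ 0) (i : Fin r) (p : ℕ) :
    (decodeTuple e he m i).factorization p = e.symm (m.factorization p) i := by
  unfold decodeTuple
  rw [if_neg hm, Nat.prod_pow_factorization_eq_self, Finsupp.mapRange_apply]
  intro q hq
  exact Nat.prime_of_mem_primeFactors (Finsupp.support_mapRange hq)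

theorem decodeTuple_pos {m : ℕ} (hm : m ≠ 0) (i : Fin r) : 0 < decodeTuple e he m i := by
  unfold decodeTuple
  rw [if_neg hm]
  refine Finset.prod_pos fun q hq => pow_pos ?_ _
  exact (Nat.prime_of_mem_primeFactors (Finsupp.support_mapRange hq)).pos

theorem decodeTuple_injective (hr : 1 ≤ r) : Function.Injective (decodeTuple e he) := by
  have h0 : ∀ m n, decodeTuple e he m = decodeTuple e he n → n = 0 → m = 0 := by
    rintro m n h rfl
    by_contra hm
    have := decodeTuple_pos (e := e) (he := he) hm ⟨0, hr⟩
    rw [h, decodeTuple_zero] at this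
    exact lt_irrefl _ this
  intro m n h
  by_cases hn : n = 0
  · rw [h0 m n h hn, hn]
  · have hm : m ≠ 0 := fun hm => hn (h0 n m h.symm hm)
    refine Nat.eq_of_factorization_eq hm hn fun p => e.symm.injective (funext fun i => ?_)
    rw [← factorization_decodeTuple (he := he) hm, ← factorization_decodeTuple (he := he) hn, h]

theorem exists_decodeTuple_eq {n : Fin r → ℕ} (hn : ∀ i, 0 < n i) :
    ∃ m, decodeTuple e he m = n := by
  have he' : e 0 = 0 := by rw [← he, Equiv.apply_symm_apply]
  -- The code of n has exponent e(v_p(n₁), …, v_p(nᵣ)) at p; since e 0 = 0, this is nonzero only at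
  -- primes dividing some nᵢ, hence finitely often.
  have hsupp : ∀ p, e (fun i => (n i).factorization p) ≠ 0 → p ∈ (∏ i, n i).primeFactors := by
    intro p hp
    by_contra hcon
    refine hp ?_
    rw [← he']
    congr 1
    funext i
    by_contra hpi
    have hpi' := Nat.support_factorization (n i) ▸ Finsupp.mem_support_iff.2 hpi
    exact hcon (Nat.primeFactors_mono (Finset.dvd_prod_of_mem n (Finset.mem_univ i))
      (Finset.prod_ne_zero_iff.2 fun i _ => (hn i).ne') hpi')
  let f : ℕ →₀ ℕ := Finsupp.onFinset _ _ hsupp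
  have hf : ∀ p ∈ f.support, p.Prime := fun p hp =>
    Nat.prime_of_mem_primeFactors (Finsupp.support_onFinset_subset hp)
  have hm : f.prod (· ^ ·) ≠ 0 :=
    Finset.prod_ne_zero_iff.2 fun p hp => pow_ne_zero _ (hf p hp).ne_zero
  refine ⟨f.prod (· ^ ·), funext fun i => Nat.eq_of_factorization_eq
    (decodeTuple_pos hm i).ne' (hn i).ne' fun p => ?_⟩
  rw [factorization_decodeTuple hm, Nat.prod_pow_factorization_eq_self hf]
  change e.symm (e _) i = _
  rw [Equiv.symm_apply_apply]

theorem decodeTuple_prime_pow {p : ℕ} (hp : p.Prime) (k : ℕ) :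
    decodeTuple e he (p ^ k) = fun i => p ^ e.symm k i := by
  have h0 : p ^ k ≠ 0 := pow_ne_zero _ hp.ne_zero
  refine funext fun i => Nat.eq_of_factorization_eq (decodeTuple_pos h0 i).ne'
    (pow_ne_zero _ hp.ne_zero) fun q => ?_
  rw [factorization_decodeTuple h0, hp.factorization_pow, hp.factorization_pow]
  by_cases hq : p = q
  · subst hq
    rw [Finsupp.single_eq_same, Finsupp.single_eq_same]
  · simp [Ne.symm hq, he]

/-- No additivity of `e` is needed: at each prime one of the two exponents is 0, and `e.symm 0 = 0`.
-/
theorem decodeTuple_mul {m n : ℕ} (hm : m ≠ 0) (hn : n ≠ 0) (h : m.Coprime n) :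
    decodeTuple e he (m * n) = fun i => decodeTuple e he m i * decodeTuple e he n i := by
  refine funext fun i => Nat.eq_of_factorization_eq (decodeTuple_pos (mul_ne_zero hm hn) i).ne'
    (mul_ne_zero (decodeTuple_pos hm i).ne' (decodeTuple_pos hn i).ne') fun p => ?_
  rw [factorization_decodeTuple (mul_ne_zero hm hn), Nat.factorization_mul hm hn,
    Nat.factorization_mul (decodeTuple_pos hm i).ne' (decodeTuple_pos hn i).ne',
    Finsupp.add_apply, Finsupp.add_apply, factorization_decodeTuple hm,
    factorization_decodeTuple hn]
  have z : m.factorization p = 0 ∨ n.factorization p = 0 := by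
    by_contra! hc
    have h1 := Nat.dvd_gcd (Nat.dvd_of_factorization_pos hc.1) (Nat.dvd_of_factorization_pos hc.2)
    rw [h] at h1
    have hp1 := Nat.dvd_one.1 h1
    rw [hp1] at hc
    exact hc.1 (Nat.factorization_eq_zero_of_not_prime m Nat.not_prime_one)
  rcases z with z | z <;> simp [z, he]

theorem coprime_decodeTuple {m n : ℕ} (hm : m ≠ 0) (hn : n ≠ 0) (h : m.Coprime n) (i j : Fin r) :
    (decodeTuple e he m i).Coprime (decodeTuple e he n j) := by
  have key : ∀ (k : ℕ), k ≠ 0 → ∀ i p, p.Prime → p ∣ decodeTuple e he k i → p ∣ k := by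
    intro k hk i p hp hd
    by_contra hpk
    have h1 := hp.factorization_pos_of_dvd (decodeTuple_pos hk i).ne' hd
    rw [factorization_decodeTuple hk, Nat.factorization_eq_zero_of_not_dvd hpk, he] at h1
    exact lt_irrefl _ h1
  refine Nat.coprime_of_dvd fun p hp h1 h2 => ?_
  exact hp.one_lt.ne' (Nat.dvd_one.1 (h ▸ Nat.dvd_gcd (key m hm i p hp h1) (key n hn j p hp h2)))

end decode

/-! ### Euler products in several variables. -/

/-- A nonnegative multiplicative function whose Euler factors are `1 + O(p⁻²)` is summable. -/
theorem summable_of_tsum_prime_pow_le_one_add {g : ℕ → ℝ} (h1 : g 1 = 1)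
    (hmul : ∀ {m n}, Nat.Coprime m n → g (m * n) = g m * g n) (hg0 : g 0 = 0) (hgn : ∀ m, 0 ≤ g m)
    (hs : ∀ {p : ℕ}, p.Prime → Summable fun k : ℕ => g (p ^ k)) {K : ℝ}
    (hK : ∀ p : ℕ, p.Prime → ∑' k : ℕ, g (p ^ k) ≤ 1 + K / (p : ℝ) ^ 2) : Summable g := by
  have hsum2 : Summable fun n : ℕ => |K| / (n : ℝ) ^ 2 := by
    simp_rw [div_eq_mul_inv]
    exact (Real.summable_nat_pow_inv.2 one_lt_two).mul_left _
  refine summable_of_sum_le (c := Real.exp (∑' n : ℕ, |K| / (n : ℝ) ^ 2)) hgn fun s => ?_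
  obtain ⟨N, hN⟩ : ∃ N : ℕ, ∀ m ∈ s, m < N :=
    ⟨s.sup id + 1, fun m hm => Nat.lt_succ_of_le (Finset.le_sup (f := id) hm)⟩
  -- Positive integers below N are N-smooth, so the partial sum is at most the finite Euler product
  -- over p < N, which 1 + x ≤ exp x bounds independently of N.
  have key : HasSum (fun m : N.smoothNumbers => g m)
      (∏ p ∈ N.primesBelow, ∑' k : ℕ, g (p ^ k)) :=
    (EulerProduct.summable_and_hasSum_smoothNumbers_prod_primesBelow_tsum h1 hmul
      (fun hp => (hs hp).norm) N).2
  have key' : HasSum ((N.smoothNumbers).indicator g)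
      (∏ p ∈ N.primesBelow, ∑' k : ℕ, g (p ^ k)) := hasSum_subtype_iff_indicator.1 key
  calc ∑ m ∈ s, g m ≤ ∑ m ∈ s, (N.smoothNumbers).indicator g m := by
        refine Finset.sum_le_sum fun m hm => ?_
        by_cases hm0 : m = 0
        · rw [hm0, hg0]
          exact Set.indicator_nonneg (fun m _ => hgn m) 0
        · rw [Set.indicator_of_mem
            (Nat.mem_smoothNumbers_of_lt (Nat.pos_of_ne_zero hm0) (hN m hm))]
    _ ≤ ∏ p ∈ N.primesBelow, ∑' k : ℕ, g (p ^ k) :=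
        sum_le_hasSum s (fun m _ => Set.indicator_nonneg (fun m _ => hgn m) m) key'
    -- With |K| the terms are nonnegative, so the sum over primes can be enlarged to all n.
    _ ≤ ∏ p ∈ N.primesBelow, Real.exp (|K| / (p : ℝ) ^ 2) := by
        refine Finset.prod_le_prod (fun p _ => tsum_nonneg fun n => hgn _) fun p hp => ?_
        refine (hK p (Nat.prime_of_mem_primesBelow hp)).trans ?_
        rw [add_comm]
        refine le_trans ?_ (Real.add_one_le_exp _)
        gcongr
        exact le_abs_self K
    _ = Real.exp (∑ p ∈ N.primesBelow, |K| / (p : ℝ) ^ 2) := (Real.exp_sum _ _).symm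
    _ ≤ Real.exp (∑' n : ℕ, |K| / (n : ℝ) ^ 2) :=
        Real.exp_le_exp.2 (hsum2.sum_le_tsum _ fun _ _ => by positivity)

section EulerProduct

variable {r : ℕ} {F : (Fin r → ℕ) → ℝ} {e : (Fin r → ℕ) ≃ ℕ} {he : e.symm 0 = 0}

theorem comp_decodeTuple_one (h1 : F (fun _ => 1) = 1) : F (decodeTuple e he 1) = 1 := by
  have := decodeTuple_prime_pow (e := e) (he := he) Nat.prime_two 0
  simp only [pow_zero, he, Pi.zero_apply] at this
  rw [this, h1]

theorem comp_decodeTuple_mul (h1 : F (fun _ => 1) = 1) (hmul : MulOnCoprime F) {m n : ℕ}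
    (h : m.Coprime n) :
    F (decodeTuple e he (m * n)) = F (decodeTuple e he m) * F (decodeTuple e he n) := by
  by_cases hm : m = 0
  · subst hm
    rw [Nat.coprime_zero_left] at h
    rw [h, mul_one, comp_decodeTuple_one h1, mul_one]
  by_cases hn : n = 0
  · subst hn
    rw [Nat.coprime_zero_right] at h
    rw [h, one_mul, comp_decodeTuple_one h1, one_mul]
  rw [decodeTuple_mul hm hn h]
  exact hmul _ _ (decodeTuple_pos hm) (decodeTuple_pos hn)
    (gcd_prod_eq_one_iff.2 (coprime_decodeTuple hm hn h))

theorem support_subset_range_decodeTuple (hpos : ∀ n, ¬ (∀ i, 0 < n i) → F n = 0)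
    (n : Fin r → ℕ) (hn : n ∉ Set.range (decodeTuple e he)) : F n = 0 :=
  hpos n fun h => hn (exists_decodeTuple_eq h)

theorem summable_of_nonneg_of_tsum_prime_pow_le (hr : 1 ≤ r) (h1 : F (fun _ => 1) = 1)
    (hmul : MulOnCoprime F) (hpos : ∀ n, ¬ (∀ i, 0 < n i) → F n = 0) (hF : ∀ n, 0 ≤ F n)
    (hs : ∀ p : ℕ, p.Prime → Summable fun ν : Fin r → ℕ => F fun i => p ^ ν i) {K : ℝ}
    (hK : ∀ p : ℕ, p.Prime → ∑' ν : Fin r → ℕ, (F fun i => p ^ ν i) ≤ 1 + K / (p : ℝ) ^ 2) :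
    Summable F := by
  obtain ⟨e, he⟩ := exists_equiv_nat hr
  rw [← (decodeTuple_injective (he := he) hr).summable_iff
    (support_subset_range_decodeTuple hpos)]
  refine summable_of_tsum_prime_pow_le_one_add (g := fun m => F (decodeTuple e he m)) (K := K)
    (comp_decodeTuple_one h1) (fun h => comp_decodeTuple_mul h1 hmul h) ?_ (fun m => hF _) ?_ ?_
  · rw [decodeTuple_zero]
    exact hpos _ fun h => lt_irrefl _ (h ⟨0, hr⟩)
  · intro p hp
    simp only [decodeTuple_prime_pow hp]
    exact e.symm.summable_iff.2 (hs p hp)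
  · intro p hp
    simp only [decodeTuple_prime_pow hp]
    rw [e.symm.tsum_eq fun ν => F fun i => p ^ ν i]
    exact hK p hp

/-- The Euler product of an absolutely convergent series over tuples. -/
theorem hasProd_tsum_prime_pow (hr : 1 ≤ r) (h1 : F (fun _ => 1) = 1)
    (hmul : MulOnCoprime F) (hpos : ∀ n, ¬ (∀ i, 0 < n i) → F n = 0) (hs : Summable F) :
    HasProd (fun p : Nat.Primes => ∑' ν : Fin r → ℕ, F fun i => (p : ℕ) ^ ν i) (∑' n, F n) := by
  obtain ⟨e, he⟩ := exists_equiv_nat hr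
  have hinj := decodeTuple_injective (he := he) hr
  have hsupp := support_subset_range_decodeTuple (e := e) (he := he) hpos
  have hsum : Summable (F ∘ decodeTuple e he) := (hinj.summable_iff hsupp).2 hs
  have key := EulerProduct.eulerProduct_hasProd (f := F ∘ decodeTuple e he)
    (comp_decodeTuple_one h1) (fun h => comp_decodeTuple_mul h1 hmul h) hsum.norm (by
      rw [Function.comp_apply, decodeTuple_zero]
      exact hpos _ fun h => lt_irrefl _ (h ⟨0, hr⟩))
  rw [((hinj.hasSum_iff hsupp).2 hs.hasSum).tsum_eq] at key
  have hfactor : (fun p : Nat.Primes => ∑' ν : Fin r → ℕ, F fun i => (p : ℕ) ^ ν i) =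
      fun p : Nat.Primes => ∑' k : ℕ, (F ∘ decodeTuple e he) ((p : ℕ) ^ k) := by
    funext p
    simp only [Function.comp_apply, decodeTuple_prime_pow p.2]
    exact (e.symm.tsum_eq fun ν => F fun i => (p : ℕ) ^ ν i).symm
  rw [hfactor]
  exact key

end EulerProduct

/-! ### Absolute convergence of the series and of the Euler product. -/

/-- Let s be the sum of the exponents. The term with s = 0 is 1 and those with s = 1 vanish. For s ≥
2, p^(-s) ≤ p^(-2) 2^(-(s-2)) = 4 p^(-2) 2^(-s), whence the factor 4. -/
theorem summable_Q_prime_pow_mul {r p : ℕ} (hr : 1 ≤ r) (hp : p.Prime) :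
    (Summable fun ν : Fin r → ℕ => |Q r fun i => p ^ ν i| * ∏ i, ((p ^ ν i : ℕ) : ℝ)⁻¹) ∧
      ∑' ν : Fin r → ℕ, |Q r fun i => p ^ ν i| * ∏ i, ((p ^ ν i : ℕ) : ℝ)⁻¹ ≤
        1 + 4 * (r : ℝ) ^ r * (∑' ν : Fin r → ℕ, ∏ i, (1 / 2 : ℝ) ^ ν i) / (p : ℝ) ^ 2 := by
  have hp0 : (0 : ℝ) < p := by exact_mod_cast hp.pos
  have hp2 : (p : ℝ)⁻¹ ≤ 1 / 2 := by
    rw [one_div]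
    exact inv_anti₀ two_pos (by exact_mod_cast hp.two_le)
  have hprod : ∀ ν : Fin r → ℕ, ∏ i, ((p ^ ν i : ℕ) : ℝ)⁻¹ = (p : ℝ)⁻¹ ^ ∑ i, ν i := fun ν => by
    rw [← Finset.prod_pow_eq_pow_sum]
    simp
  have hbound : ∀ ν : Fin r → ℕ, |Q r fun i => p ^ ν i| * ∏ i, ((p ^ ν i : ℕ) : ℝ)⁻¹ ≤
      (if ν = 0 then 1 else 0) +
        4 * (r : ℝ) ^ r / (p : ℝ) ^ 2 * ∏ i, (1 / 2 : ℝ) ^ ν i := by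
    intro ν
    by_cases h0 : ν = 0
    · subst h0
      rw [if_pos rfl]
      simp only [Pi.zero_apply, pow_zero, Q_one, Nat.cast_one, inv_one, Finset.prod_const_one,
        abs_one, mul_one]
      have : 0 ≤ 4 * (r : ℝ) ^ r / (p : ℝ) ^ 2 := by positivity
      linarith
    rw [if_neg h0, zero_add, hprod, Finset.prod_pow_eq_pow_sum]
    have hs0 : ∑ i, ν i ≠ 0 := by
      intro h
      rw [Finset.sum_eq_zero_iff] at h
      exact h0 (funext fun i => h i (Finset.mem_univ i))
    by_cases hs1 : ∑ i, ν i = 1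
    · rw [Q_prime_pow_eq_zero hp ν hs1, abs_zero, zero_mul]
      positivity
    obtain ⟨k, hk⟩ : ∃ k, ∑ i, ν i = k + 2 := ⟨∑ i, ν i - 2, by omega⟩
    rw [hk, pow_add, pow_add]
    calc |Q r fun i => p ^ ν i| * ((p : ℝ)⁻¹ ^ k * (p : ℝ)⁻¹ ^ 2)
        ≤ (r : ℝ) ^ r * ((1 / 2) ^ k * (p : ℝ)⁻¹ ^ 2) := by
          gcongr
          exact abs_Q_prime_pow_le hr hp ν
      _ = 4 * (r : ℝ) ^ r / (p : ℝ) ^ 2 * ((1 / 2) ^ k * (1 / 2) ^ 2) := by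
          field_simp
          norm_num
  have hs1 : HasSum (fun ν : Fin r → ℕ => if ν = 0 then (1 : ℝ) else 0) 1 :=
    hasSum_ite_eq 0 1
  have hs2 := ((summable_prod_half_pow r).hasSum.mul_left (4 * (r : ℝ) ^ r / (p : ℝ) ^ 2))
  have hs := hs1.add hs2
  have hsum : Summable fun ν : Fin r → ℕ =>
      |Q r fun i => p ^ ν i| * ∏ i, ((p ^ ν i : ℕ) : ℝ)⁻¹ :=
    hs.summable.of_nonneg_of_le (fun ν => by positivity) hbound
  refine ⟨hsum, (hsum.tsum_le_tsum hbound hs.summable).trans_eq ?_⟩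
  rw [hs.tsum_eq]
  ring

/-- This series dominates both the one behind the Euler product and the normalized counts in the
density limit. -/
theorem summable_abs_Q_mul {r : ℕ} (hr : 1 ≤ r) :
    Summable fun d : Fin r → ℕ => |Q r d| * ∏ i, (d i : ℝ)⁻¹ := by
  refine summable_of_nonneg_of_tsum_prime_pow_le hr ?_ ?_ ?_ (fun d => by positivity)
    (fun p hp => (summable_Q_prime_pow_mul hr hp).1)
    (fun p hp => (summable_Q_prime_pow_mul hr hp).2)
  · simp [Q_one]
  · intro m n hm hn h
    simp only [mulOnCoprime_Q r m n hm hn h, abs_mul, Nat.cast_mul, mul_inv, Finset.prod_mul_distrib]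
    ring
  · intro n hn
    rw [Q_eq_zero_of_not_pos hn, abs_zero, zero_mul]

theorem totient_div_sq_le (n : ℕ) : (n.totient : ℝ) / (n : ℝ) ^ 2 ≤ (n : ℝ)⁻¹ := by
  rcases Nat.eq_zero_or_pos n with rfl | hn
  · simp
  have hn' : (0 : ℝ) < n := by exact_mod_cast hn
  have : (n.totient : ℝ) ≤ n := by exact_mod_cast n.totient_le
  calc (n.totient : ℝ) / (n : ℝ) ^ 2 ≤ n / (n : ℝ) ^ 2 := by gcongr
    _ = (n : ℝ)⁻¹ := by field_simp

theorem norm_Q_mul_le {r : ℕ} (d : Fin r → ℕ) :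
    ‖Q r d * ∏ i, ((d i).totient : ℝ) / (d i : ℝ) ^ 2‖ ≤ |Q r d| * ∏ i, (d i : ℝ)⁻¹ := by
  have h0 : 0 ≤ ∏ i, ((d i).totient : ℝ) / (d i : ℝ) ^ 2 :=
    Finset.prod_nonneg fun _ _ => by positivity
  rw [norm_mul, Real.norm_eq_abs, Real.norm_of_nonneg h0]
  exact mul_le_mul_of_nonneg_left (Finset.prod_le_prod (fun _ _ => by positivity)
    fun i _ => totient_div_sq_le (d i)) (abs_nonneg _)

theorem eulerTerm_eq (r p : ℕ) (ν : Fin r → ℕ) :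
    eulerTerm r p ν = Q r (fun i => p ^ ν i) *
      ∏ i, ((p ^ ν i).totient : ℝ) / ((p ^ ν i : ℕ) : ℝ) ^ 2 := by
  unfold eulerTerm
  rw [Finset.prod_div_distrib, mul_div_assoc, pow_mul', ← Finset.prod_pow_eq_pow_sum,
    ← Finset.prod_pow]
  simp only [Nat.cast_pow]

theorem summable_eulerTerm {r p : ℕ} (hr : 1 ≤ r) (hp : p.Prime) : Summable (eulerTerm r p) := by
  refine Summable.of_norm_bounded (summable_Q_prime_pow_mul hr hp).1 fun ν => ?_
  rw [eulerTerm_eq]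
  exact norm_Q_mul_le fun i => p ^ ν i

theorem hasProd_tsum_eulerTerm {r : ℕ} (hr : 1 ≤ r) :
    HasProd (fun p : Nat.Primes => ∑' ν : Fin r → ℕ, eulerTerm r p ν)
      (∑' d : Fin r → ℕ, Q r d * ∏ i, ((d i).totient : ℝ) / (d i : ℝ) ^ 2) := by
  simp only [eulerTerm_eq]
  refine hasProd_tsum_prime_pow
    (F := fun d => Q r d * ∏ i, ((d i).totient : ℝ) / (d i : ℝ) ^ 2) hr ?_ ?_ ?_
    (Summable.of_norm_bounded (summable_abs_Q_mul hr) norm_Q_mul_le)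
  · simp [Q_one]
  · intro m n hm hn h
    have hc := gcd_prod_eq_one_iff.1 h
    simp only [mulOnCoprime_Q r m n hm hn h, Nat.totient_mul (hc _ _), Nat.cast_mul, mul_pow,
      mul_div_mul_comm, Finset.prod_mul_distrib]
    ring
  · intro n hn
    rw [Q_eq_zero_of_not_pos hn, zero_mul]

/-! ### Counting the integers with a given unitary divisor. -/

/-- The number of `n ≤ x` that have `d` as a unitary divisor. -/
noncomputable def unitaryMultiplesCount (d : ℕ) (x : ℝ) : ℕ :=
  ((Finset.Icc 1 ⌊x⌋₊).filter fun n => d ∈ unitaryDivisors n).card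

theorem unitaryMultiplesCount_eq {d : ℕ} (hd : 0 < d) (x : ℝ) :
    unitaryMultiplesCount d x =
      ((Finset.Ico 1 (1 + ⌊x⌋₊ / d)).filter fun m => d.Coprime m).card := by
  unfold unitaryMultiplesCount
  symm
  refine Finset.card_bij' (fun m _ => d * m) (fun n _ => n / d) ?_ ?_ ?_ ?_
  · intro m hm
    simp only [Finset.mem_filter, Finset.mem_Ico, Finset.mem_Icc] at hm ⊢
    obtain ⟨⟨h1, h2⟩, h3⟩ := hm
    refine ⟨⟨Nat.mul_pos hd h1, ?_⟩, mem_unitaryDivisors_iff.2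
      ⟨(Nat.mul_pos hd h1).ne', m, rfl, h3⟩⟩
    rw [mul_comm]
    exact (Nat.le_div_iff_mul_le hd).1 (by omega)
  · intro n hn
    simp only [Finset.mem_filter, Finset.mem_Ico, Finset.mem_Icc] at hn ⊢
    obtain ⟨⟨h1, h2⟩, h3⟩ := hn
    have h4 := div_pos_of_mem_unitaryDivisors h3
    have h5 : n / d ≤ ⌊x⌋₊ / d := Nat.div_le_div_right h2
    exact ⟨⟨h4, by omega⟩, (Finset.mem_filter.1 h3).2⟩
  · exact fun m _ => Nat.mul_div_cancel_left m hd
  · exact fun n hn => Nat.mul_div_cancel' (dvd_of_mem_unitaryDivisors (Finset.mem_filter.1 hn).2)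

theorem unitaryMultiplesCount_zero (x : ℝ) : unitaryMultiplesCount 0 x = 0 := by
  unfold unitaryMultiplesCount
  rw [Finset.card_eq_zero, Finset.filter_eq_empty_iff]
  exact fun n _ h => lt_irrefl _ (pos_of_mem_unitaryDivisors h)

/-- Each block of d consecutive integers contains φ(d) integers coprime to d. -/
theorem card_coprime_Ico_mul (d q : ℕ) :
    ((Finset.Ico 1 (1 + d * q)).filter fun m => d.Coprime m).card = d.totient * q := by
  induction q with
  | zero => simp
  | succ q ih =>
    have hd : Disjoint (Finset.Ico 1 (1 + d * q)) (Finset.Ico (1 + d * q) (1 + d * q + d)) :=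
      Finset.Ico_disjoint_Ico_consecutive _ _ _
    rw [mul_add, mul_one, ← add_assoc, ← Finset.Ico_union_Ico_eq_Ico (b := 1 + d * q)
      (Nat.le_add_right _ _) (Nat.le_add_right _ _), Finset.filter_union,
      Finset.card_union_of_disjoint (Finset.disjoint_filter_filter hd), ih,
      Nat.filter_coprime_Ico_eq_totient]
    ring

/-- The cofactors m range over 1, …, ⌊x⌋/d, which contains ⌊x/d²⌋ full blocks of length d and less
than one further block. -/
theorem floor_le_unitaryMultiplesCount {d : ℕ} (hd : 0 < d) (x : ℝ) :
    d.totient * ⌊x / (d : ℝ) ^ 2⌋₊ ≤ unitaryMultiplesCount d x ∧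
      unitaryMultiplesCount d x ≤ d.totient * (⌊x / (d : ℝ) ^ 2⌋₊ + 1) := by
  have e : ⌊x / (d : ℝ) ^ 2⌋₊ = ⌊x⌋₊ / d / d := by
    rw [← Nat.cast_pow, Nat.floor_div_natCast, sq, Nat.div_div_eq_div_mul]
  rw [e, unitaryMultiplesCount_eq hd, ← card_coprime_Ico_mul, ← card_coprime_Ico_mul]
  have h1 := Nat.mul_div_le (⌊x⌋₊ / d) d
  have h2 := Nat.lt_mul_div_succ (⌊x⌋₊ / d) hd
  constructor <;> refine Finset.card_le_card (Finset.filter_subset_filter _ ?_) <;>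
    refine Finset.Ico_subset_Ico_right ?_ <;> omega

/-- Dropping the coprimality condition gives a bound uniform in x, as dominated convergence
requires. -/
theorem unitaryMultiplesCount_div_le (d : ℕ) {x : ℝ} (hx : 0 < x) :
    (unitaryMultiplesCount d x : ℝ) / x ≤ (d : ℝ)⁻¹ := by
  rcases Nat.eq_zero_or_pos d with rfl | hd
  · simp [unitaryMultiplesCount_zero]
  have h : unitaryMultiplesCount d x ≤ ⌊x⌋₊ / d := by
    rw [unitaryMultiplesCount_eq hd]
    refine (Finset.card_filter_le _ _).trans ?_
    simp
  have h' : (unitaryMultiplesCount d x : ℝ) ≤ x / d :=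
    calc (unitaryMultiplesCount d x : ℝ) ≤ ((⌊x⌋₊ / d : ℕ) : ℝ) := by exact_mod_cast h
      _ ≤ (⌊x⌋₊ : ℝ) / d := Nat.cast_div_le
      _ ≤ x / d := by
        gcongr
        exact Nat.floor_le hx.le
  rw [div_le_iff₀ hx]
  exact h'.trans_eq (by ring)

theorem tendsto_unitaryMultiplesCount_div {d : ℕ} (hd : 0 < d) :
    Tendsto (fun x : ℝ => (unitaryMultiplesCount d x : ℝ) / x) atTop
      (𝓝 ((d.totient : ℝ) / (d : ℝ) ^ 2)) := by
  have hd0 : (0 : ℝ) ≤ 1 / (d : ℝ) ^ 2 := by positivity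
  have h1 : Tendsto (fun x : ℝ => (d.totient : ℝ) * ((⌊x / (d : ℝ) ^ 2⌋₊ : ℝ) / x)) atTop
      (𝓝 ((d.totient : ℝ) / (d : ℝ) ^ 2)) := by
    have := (tendsto_nat_floor_mul_div_atTop hd0).const_mul (d.totient : ℝ)
    simp only [one_div_mul_eq_div, mul_one_div] at this
    exact this
  have h2 : Tendsto (fun x : ℝ => (d.totient : ℝ) * ((⌊x / (d : ℝ) ^ 2⌋₊ : ℝ) / x) +
      (d.totient : ℝ) / x) atTop (𝓝 ((d.totient : ℝ) / (d : ℝ) ^ 2)) := by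
    simpa using h1.add (tendsto_const_nhds.div_atTop tendsto_id)
  refine tendsto_of_tendsto_of_tendsto_of_le_of_le' h1 h2 ?_ ?_
  · filter_upwards [eventually_gt_atTop 0] with x hx
    rw [← mul_div_assoc]
    gcongr
    exact_mod_cast (floor_le_unitaryMultiplesCount hd x).1
  · filter_upwards [eventually_gt_atTop 0] with x hx
    rw [← mul_div_assoc, ← add_div]
    gcongr
    have := (floor_le_unitaryMultiplesCount hd x).2
    rw [mul_add, mul_one] at this
    exact_mod_cast this

/-! ### The asymptotic density. -/

theorem sum_rhoUnitary_eq_tsum {r : ℕ} (x : Fin r → ℝ) :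
    ∑ n ∈ Fintype.piFinset (fun i => Finset.Icc 1 ⌊x i⌋₊), rhoUnitary r n =
      ∑' d : Fin r → ℕ, Q r d * ∏ i, (unitaryMultiplesCount (d i) (x i) : ℝ) := by
  set B := Fintype.piFinset (fun i => Finset.Icc 1 ⌊x i⌋₊) with hB
  have hcount : ∀ d : Fin r → ℕ, ∏ i, (unitaryMultiplesCount (d i) (x i) : ℝ) =
      ∑ n ∈ B, if d ∈ Fintype.piFinset (fun i => unitaryDivisors (n i)) then 1 else 0 := by
    intro d
    simp only [unitaryMultiplesCount, Finset.card_filter, Nat.cast_sum, Nat.cast_ite, Nat.cast_one,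
      Nat.cast_zero]
    rw [Finset.prod_univ_sum, hB]
    refine Finset.sum_congr rfl fun n _ => ?_
    rw [Finset.prod_ite_zero]
    simp only [Finset.mem_univ, true_imp_iff, Finset.prod_const_one, Fintype.mem_piFinset]
  have hsub : ∀ n ∈ B, Fintype.piFinset (fun i => unitaryDivisors (n i)) ⊆ B := by
    intro n hn d hd
    rw [Fintype.mem_piFinset] at hn hd ⊢
    intro i
    have h1 := Finset.mem_Icc.1 (hn i)
    exact Finset.mem_Icc.2 ⟨pos_of_mem_unitaryDivisors (hd i),
      (Nat.le_of_dvd h1.1 (dvd_of_mem_unitaryDivisors (hd i))).trans h1.2⟩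
  -- Unitary divisors of points of the box lie in the box, so the series is a finite sum over B and
  -- the order of summation can be exchanged.
  rw [tsum_eq_sum (s := B)]
  · simp only [hcount, Finset.mul_sum, mul_ite, mul_one, mul_zero]
    rw [Finset.sum_comm]
    refine Finset.sum_congr rfl fun n hn => ?_
    rw [← sum_Q_unitaryDivisors fun i => Nat.one_le_iff_ne_zero.1
      (Finset.mem_Icc.1 (Fintype.mem_piFinset.1 hn i)).1, Finset.sum_ite_mem,
      Finset.inter_eq_right.2 (hsub n hn)]
  · intro d hd
    rw [hcount, Finset.sum_eq_zero, mul_zero]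
    exact fun n hn => if_neg fun h => hd (hsub n hn h)

theorem hasAsymptoticDensity_pairwiseUnitaryCoprime {r : ℕ} (hr : 1 ≤ r) :
    HasAsymptoticDensity (pairwiseUnitaryCoprime r) (unitaryDensityConst r) := by
  unfold HasAsymptoticDensity HasMeanValue unitaryDensityConst
  rw [(hasProd_tsum_eulerTerm hr).tprod_eq]
  have e : ∀ x : Fin r → ℝ,
      (∑ n ∈ Fintype.piFinset (fun i => Finset.Icc 1 ⌊x i⌋₊),
        (pairwiseUnitaryCoprime r).indicator 1 n) / ∏ i, x i =
      ∑' d : Fin r → ℕ, Q r d * ∏ i, (unitaryMultiplesCount (d i) (x i) : ℝ) / x i := by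
    intro x
    refine (congrArg (· / ∏ i, x i) (sum_rhoUnitary_eq_tsum x)).trans ?_
    rw [← tsum_div_const]
    simp only [Finset.prod_div_distrib, mul_div_assoc]
  simp only [e]
  have hev : ∀ i : Fin r, Tendsto (fun x : Fin r → ℝ => x i)
      (Filter.pi fun _ => (atTop : Filter ℝ)) atTop := fun i => tendsto_eval_pi _ i
  -- Termwise, each of the r factors converges along its own coordinate xᵢ → ∞; the majorant holds
  -- as soon as all xᵢ > 0, so the coordinates may grow independently.
  refine tendsto_tsum_of_dominated_convergence (summable_abs_Q_mul hr) ?_ ?_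
  · intro d
    by_cases hd : ∀ i, 0 < d i
    · exact (tendsto_finsetProd _ fun i _ =>
        (tendsto_unitaryMultiplesCount_div (hd i)).comp (hev i)).const_mul _
    · simp only [Q_eq_zero_of_not_pos hd, zero_mul]
      exact tendsto_const_nhds
  · filter_upwards [eventually_all.2 fun i => (hev i).eventually (eventually_gt_atTop 0)]
      with x hx d
    have h0 : ∀ i, 0 ≤ (unitaryMultiplesCount (d i) (x i) : ℝ) / x i := fun i =>
      div_nonneg (Nat.cast_nonneg _) (hx i).le
    rw [norm_mul, Real.norm_eq_abs, Real.norm_of_nonneg (Finset.prod_nonneg fun i _ => h0 i)]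
    exact mul_le_mul_of_nonneg_left (Finset.prod_le_prod (fun i _ => h0 i)
      fun i _ => unitaryMultiplesCount_div_le (d i) (hx i)) (abs_nonneg _)

end UnitaryDensity

theorem mainTheorem2 (r : ℕ) (hr : 2 ≤ r) :
    -- `Q` is multiplicative, with the stated values at powers of a prime
    UnitaryDensity.IsMultiplicative (UnitaryDensity.Q r) ∧
    (∀ (p : ℕ), p.Prime → ∀ ν : Fin r → ℕ,
      UnitaryDensity.Q r (fun i => p ^ ν i) =
        (-1) ^ (∑ v ∈ UnitaryDensity.positiveValues ν, UnitaryDensity.multiplicity ν v) *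
          ∏ v ∈ UnitaryDensity.positiveValues ν,
            (1 - (UnitaryDensity.multiplicity ν v : ℝ))) ∧
    -- the series and the Euler product converge
    (∀ p : Nat.Primes, Summable (UnitaryDensity.eulerTerm r p)) ∧
    Multipliable (fun p : Nat.Primes => ∑' ν : Fin r → ℕ, UnitaryDensity.eulerTerm r p ν) ∧
    -- its value is the asymptotic density
    UnitaryDensity.HasAsymptoticDensity (UnitaryDensity.pairwiseUnitaryCoprime r)
      (UnitaryDensity.unitaryDensityConst r) := by
  have hr1 : 1 ≤ r := one_le_two.trans hr
  exact ⟨UnitaryDensity.isMultiplicative_Q r, fun _ hp ν => UnitaryDensity.Q_prime_pow hp ν,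
    fun p => UnitaryDensity.summable_eulerTerm hr1 p.2,
    (UnitaryDensity.hasProd_tsum_eulerTerm hr1).multipliable,
    UnitaryDensity.hasAsymptoticDensity_pairwiseUnitaryCoprime hr1⟩
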